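/- For a compact convex set $S\subset\mathbb{C}$, let its perimeter be the length (one-dimensional Hausdorff measure) of its boundary $\partial S$, counted twice if $S$ has empty interior (so that a segment of length $L$ has perimeter $2L$, and a point or the empty set has perimeter $0$). Let $S_1$ and $S_2$ be compact convex subsets of $\mathbb{C}$ with $S_1\subseteq S_2$. Then their perimeters are finite and the perimeter of $S_1$ is at most the perimeter of $S_2$. -/

import Mathlib

/-- The perimeter of a compact convex set `S ⊆ ℂ`: the length (one-dimensional Hausdorff measure)
of its boundary curve. If `S` has empty interior, i.e. if `S` is empty, a point or a line segment,
the closed boundary curve runs through `S` once in each direction, so its length counts twice: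
a segment of length `L` has perimeter `2 * L` and a point has perimeter `0`. -/
noncomputable def convexPerimeter (S : Set ℂ) : ENNReal :=
  open scoped Classical in
  if (interior S).Nonempty then MeasureTheory.Measure.hausdorffMeasure 1 (frontier S)
  else 2 * MeasureTheory.Measure.hausdorffMeasure 1 (frontier S)

open MeasureTheory Set
open scoped ENNReal NNReal RealInnerProductSpace

section InnerProduct

variable {E : Type*} [NormedAddCommGroup E] [InnerProductSpace ℝ E]

/-! Push each boundary point of `S₁` along an outward normal until it meets `frontier S₂`. By
convexity this decreases no distance (it inverts the contracting nearest-point projection), so the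
image, a part of `frontier S₂`, is at least as long as `frontier S₁`. A flat `S₁` inside the
interior of `S₂` can be pushed along both `n` and `-n`, with disjoint images, which accounts for the
factor 2. Finiteness follows by comparison with a disk. -/

/-- Moving two points outwards along normal directions does not decrease their distance. -/
theorem norm_sub_le_norm_add_smul_sub_add_smul {p q n m : E} {t s : ℝ} (ht : 0 ≤ t) (hs : 0 ≤ s)
    (hn : ⟪n, q - p⟫ ≤ 0) (hm : ⟪m, p - q⟫ ≤ 0) :
    ‖p - q‖ ≤ ‖(p + t • n) - (q + s • m)‖ := by
  rcases eq_or_ne (p - q) 0 with h | h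
  · simp [h]
  have hpos : 0 < ‖p - q‖ := norm_pos_iff.2 h
  have hn' : 0 ≤ ⟪n, p - q⟫ := by
    rw [← neg_sub q p, inner_neg_right]
    linarith
  -- Both normal terms only increase the pairing with `p - q`; Cauchy–Schwarz then bounds it by the
  -- new distance.
  have key : ⟪(p + t • n) - (q + s • m), p - q⟫
      = ‖p - q‖ * ‖p - q‖ + t * ⟪n, p - q⟫ - s * ⟪m, p - q⟫ := by
    rw [show (p + t • n) - (q + s • m) = (p - q) + t • n - s • m by abel, inner_sub_left,
      inner_add_left, real_inner_smul_left, real_inner_smul_left, real_inner_self_eq_norm_mul_norm]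
  have hle := real_inner_le_norm ((p + t • n) - (q + s • m)) (p - q)
  have h1 := mul_nonneg ht hn'
  have h2 := mul_nonneg hs (neg_nonneg.2 hm)
  refine le_of_mul_le_mul_right ?_ hpos
  linarith

/-- If every point of `T` can be moved into `F` along an outward normal direction of `T`, then `F`
is at least as long as `T`. -/
theorem hausdorffMeasure_one_le_of_normals [MeasurableSpace E] [BorelSpace E] {T F : Set E}
    (h : ∀ p ∈ T, ∃ n : E, (∀ q ∈ T, ⟪n, q - p⟫ ≤ 0) ∧ ∃ t : ℝ, 0 ≤ t ∧ p + t • n ∈ F) :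
    Measure.hausdorffMeasure 1 T ≤ Measure.hausdorffMeasure 1 F := by
  choose! n hn t ht hF using h
  -- The choices need no continuity or measurability: an expanding map already suffices.
  let g : T → E := fun p => p + t p • n p
  have hg : AntilipschitzWith 1 g := AntilipschitzWith.of_le_mul_dist fun p q => by
    rw [NNReal.coe_one, one_mul, Subtype.dist_eq, dist_eq_norm, dist_eq_norm]
    exact norm_sub_le_norm_add_smul_sub_add_smul (ht _ p.2) (ht _ q.2) (hn _ p.2 _ q.2)
      (hn _ q.2 _ p.2)
  calc Measure.hausdorffMeasure 1 T
      = Measure.hausdorffMeasure 1 (univ : Set T) := by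
        rw [← (isometry_subtype_coe (s := T)).hausdorffMeasure_image (Or.inl zero_le_one),
          image_univ, Subtype.range_coe]
    _ ≤ Measure.hausdorffMeasure 1 (g '' univ) := by
        simpa using hg.le_hausdorffMeasure_image zero_le_one univ
    _ ≤ Measure.hausdorffMeasure 1 F := by
        refine measure_mono ?_
        rintro _ ⟨p, -, rfl⟩
        exact hF _ p.2

theorem IsPreconnected.exists_mem_frontier {X : Type*} [TopologicalSpace X] {C S : Set X}
    (hC : IsPreconnected C) (hin : (C ∩ S).Nonempty) (hout : (C \ S).Nonempty) :
    (C ∩ frontier S).Nonempty := by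
  by_contra h
  have hfr : ∀ z ∈ C, z ∉ frontier S := fun z hz hzF => h ⟨z, hz, hzF⟩
  obtain ⟨x, hxC, hxS⟩ := hin
  obtain ⟨y, hyC, hyS⟩ := hout
  obtain ⟨z, -, hz, hz'⟩ := hC (interior S) (closure S)ᶜ isOpen_interior isClosed_closure.isOpen_compl
    (fun z hz => or_iff_not_imp_left.2 fun hzi hzc => hfr z hz ⟨hzc, hzi⟩)
    ⟨x, hxC, by_contra fun hxi => hfr x hxC ⟨subset_closure hxS, hxi⟩⟩
    ⟨y, hyC, fun hyc => hfr y hyC ⟨hyc, fun hyi => hyS (interior_subset hyi)⟩⟩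
  exact hz' (interior_subset_closure hz)

theorem Bornology.IsBounded.exists_add_smul_mem_frontier {S : Set E} (hS : Bornology.IsBounded S)
    {p n : E} (hp : p ∈ S) (hn : n ≠ 0) : ∃ t : ℝ, 0 ≤ t ∧ p + t • n ∈ frontier S := by
  have hconn : IsPreconnected ((fun t : ℝ => p + t • n) '' Ici 0) :=
    isPreconnected_Ici.image _ (by fun_prop)
  obtain ⟨R, hR⟩ := hS.subset_closedBall p
  have hnpos : 0 < ‖n‖ := norm_pos_iff.2 hn
  have hRnn : 0 ≤ R := by simpa using (dist_nonneg.trans (Metric.mem_closedBall.1 (hR hp)))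
  -- This point is at distance `R + 1` from `p`, outside the ball of radius `R` about `p`.
  have hout : p + ((R + 1) / ‖n‖) • n ∉ S := fun h => by
    have := hR h
    rw [mem_closedBall_iff_norm, add_sub_cancel_left, norm_smul, Real.norm_of_nonneg (by positivity),
      div_mul_cancel₀ _ hnpos.ne'] at this
    linarith
  obtain ⟨_, ⟨t, ht, rfl⟩, htF⟩ := hconn.exists_mem_frontier
    ⟨p, ⟨0, by simp, by simp⟩, hp⟩ ⟨_, ⟨(R + 1) / ‖n‖, by simp only [mem_Ici]; positivity, rfl⟩, hout⟩
  exact ⟨t, ht, htF⟩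

theorem Convex.exists_normal_of_mem_frontier [CompleteSpace E] {S : Set E} (hS : Convex ℝ S)
    (hint : (interior S).Nonempty) {p : E} (hp : p ∈ frontier S) :
    ∃ n : E, n ≠ 0 ∧ ∀ q ∈ S, ⟪n, q - p⟫ ≤ 0 := by
  obtain ⟨f, hf, hle⟩ := geometric_hahn_banach_of_nonempty_interior_point hS hp.2 hint
  refine ⟨(InnerProductSpace.toDual ℝ E).symm f, by simpa using hf, fun q hq => ?_⟩
  rw [InnerProductSpace.toDual_symm_apply, map_sub, sub_nonpos]
  exact hle q hq

/-- The affine span is proper, so its direction has a nonzero orthogonal vector. -/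
theorem Convex.exists_normal_of_interior_eq_empty [FiniteDimensional ℝ E] [Nontrivial E] {S : Set E}
    (hS : Convex ℝ S) (hint : interior S = ∅) :
    ∃ n : E, n ≠ 0 ∧ ∀ p ∈ S, ∀ q ∈ S, ⟪n, q - p⟫ = 0 := by
  rcases S.eq_empty_or_nonempty with rfl | hne
  · obtain ⟨n, hn⟩ := exists_ne (0 : E)
    exact ⟨n, hn, by simp⟩
  have hspan : affineSpan ℝ S ≠ ⊤ := fun h => by
    simpa [hint] using hS.interior_nonempty_iff_affineSpan_eq_top.2 h
  have hdir : (affineSpan ℝ S).direction ≠ ⊤ := fun h =>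
    hspan ((AffineSubspace.direction_eq_top_iff_of_nonempty (hne.mono (subset_affineSpan ℝ S))).1 h)
  obtain ⟨n, hn, hn0⟩ := Submodule.exists_mem_ne_zero_of_ne_bot
    (mt (Submodule.orthogonal_eq_bot_iff (K := (affineSpan ℝ S).direction)).1 hdir)
  refine ⟨n, hn0, fun p hp q hq => ?_⟩
  rw [real_inner_comm]
  exact hn _ (AffineSubspace.vsub_mem_direction (subset_affineSpan ℝ S hq)
    (subset_affineSpan ℝ S hp))

variable [MeasurableSpace E] [BorelSpace E]

theorem Convex.hausdorffMeasure_frontier_le [CompleteSpace E] {S₁ S₂ : Set E} (hS₁ : Convex ℝ S₁)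
    (hclosed : IsClosed S₁) (hint : (interior S₁).Nonempty) (hS₂ : Bornology.IsBounded S₂)
    (hsub : S₁ ⊆ S₂) :
    Measure.hausdorffMeasure 1 (frontier S₁) ≤ Measure.hausdorffMeasure 1 (frontier S₂) := by
  refine hausdorffMeasure_one_le_of_normals fun p hp => ?_
  obtain ⟨n, hn0, hn⟩ := hS₁.exists_normal_of_mem_frontier hint hp
  exact ⟨n, fun q hq => hn q (hclosed.frontier_subset hq),
    hS₂.exists_add_smul_mem_frontier (hsub (hclosed.frontier_subset hp)) hn0⟩

/-- A flat set in the interior of a bounded set has at most half the length of the frontier: it can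
be pushed to the frontier on both sides. -/
theorem two_mul_hausdorffMeasure_le_frontier {T S : Set E} {n : E} (hn0 : n ≠ 0)
    (hn : ∀ p ∈ T, ∀ q ∈ T, ⟪n, q - p⟫ = 0) (hS : Bornology.IsBounded S) (hT : T ⊆ interior S) :
    2 * Measure.hausdorffMeasure 1 T ≤ Measure.hausdorffMeasure 1 (frontier S) := by
  rcases T.eq_empty_or_nonempty with rfl | ⟨c, hc⟩
  · simp
  let U : Set E := {z | 0 < ⟪n, z - c⟫}
  have hU : MeasurableSet U :=
    (isOpen_lt continuous_const (by fun_prop : Continuous fun z : E => ⟪n, z - c⟫)).measurableSet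
  have hinner : ∀ p ∈ T, ∀ t : ℝ, ⟪n, p + t • n - c⟫ = t * (‖n‖ * ‖n‖) := fun p hp t => by
    rw [add_sub_right_comm, inner_add_right, hn c hc p hp, zero_add, real_inner_smul_right,
      real_inner_self_eq_norm_mul_norm]
  have hupper : Measure.hausdorffMeasure 1 T ≤ Measure.hausdorffMeasure 1 (frontier S ∩ U) := by
    refine hausdorffMeasure_one_le_of_normals fun p hp => ⟨n, fun q hq => (hn p hp q hq).le, ?_⟩
    obtain ⟨t, ht, htF⟩ := hS.exists_add_smul_mem_frontier (interior_subset (hT hp)) hn0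
    refine ⟨t, ht, htF, ?_⟩
    -- Starting in the interior forces a strict move, so the upper image avoids the lower one.
    have ht0 : t ≠ 0 := by
      rintro rfl
      rw [zero_smul, add_zero] at htF
      exact htF.2 (hT hp)
    have := norm_pos_iff.2 hn0
    have := ht.lt_of_ne' ht0
    simp only [U, mem_ofPred_eq, hinner p hp]
    positivity
  have hlower : Measure.hausdorffMeasure 1 T ≤ Measure.hausdorffMeasure 1 (frontier S \ U) := by
    refine hausdorffMeasure_one_le_of_normals fun p hp =>
      ⟨-n, fun q hq => by rw [inner_neg_left, hn p hp q hq, neg_zero], ?_⟩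
    obtain ⟨t, ht, htF⟩ :=
      hS.exists_add_smul_mem_frontier (interior_subset (hT hp)) (neg_ne_zero.2 hn0)
    refine ⟨t, ht, htF, ?_⟩
    have := mul_nonneg ht (mul_self_nonneg ‖n‖)
    simp only [U, mem_ofPred_eq, smul_neg, ← neg_smul, hinner p hp]
    linarith
  rw [two_mul, ← measure_inter_add_sdiff (frontier S) hU]
  exact add_le_add hupper hlower

theorem Convex.two_mul_hausdorffMeasure_le_frontier [FiniteDimensional ℝ E] [Nontrivial E]
    {S₁ S₂ : Set E} (hS₁ : Convex ℝ S₁) (hint₁ : interior S₁ = ∅) (hS₂ : Convex ℝ S₂)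
    (hbdd : Bornology.IsBounded S₂) (hint₂ : (interior S₂).Nonempty) (hsub : S₁ ⊆ S₂) :
    2 * Measure.hausdorffMeasure 1 S₁ ≤ Measure.hausdorffMeasure 1 (frontier S₂) := by
  obtain ⟨n, hn0, hn⟩ := hS₁.exists_normal_of_interior_eq_empty hint₁
  obtain ⟨c, hc⟩ := hint₂
  -- `S₁` may touch `frontier S₂`; shrinking it by `a < 1` towards the interior point `c` moves it
  -- into the interior and scales length by `a`.
  refine ENNReal.le_of_forall_lt_one_mul_le fun a ha => ?_
  lift a to ℝ≥0 using ha.ne_top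
  rcases eq_or_ne a 0 with rfl | ha0
  · simp
  have ha0' : (a : ℝ) ≠ 0 := by exact_mod_cast ha0
  have ha1 : (a : ℝ) < 1 := by exact_mod_cast ha
  have h := _root_.two_mul_hausdorffMeasure_le_frontier (S := S₂)
    (T := AffineMap.homothety c (a : ℝ) '' S₁) hn0 ?_ hbdd ?_
  · rw [hausdorffMeasure_homothety_image zero_le_one c ha0', NNReal.rpow_one, ENNReal.smul_def,
      smul_eq_mul] at h
    rw [mul_left_comm]
    simpa using h
  · rintro _ ⟨p, hp, rfl⟩ _ ⟨q, hq, rfl⟩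
    simp only [AffineMap.homothety_apply, vsub_eq_sub, vadd_eq_add]
    rw [add_sub_add_right_eq_sub, ← smul_sub, sub_sub_sub_cancel_right, real_inner_smul_right,
      hn p hp q hq, mul_zero]
  · rintro _ ⟨p, hp, rfl⟩
    have := hS₂.combo_interior_self_mem_interior hc (hsub hp) (sub_pos.2 ha1) a.2 (by simp)
    rwa [AffineMap.homothety_eq_lineMap, AffineMap.lineMap_apply_module]

end InnerProduct

theorem convexPerimeter_mono {S₁ S₂ : Set ℂ} (hcompact₁ : IsCompact S₁) (hconvex₁ : Convex ℝ S₁)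
    (hcompact₂ : IsCompact S₂) (hconvex₂ : Convex ℝ S₂) (hsub : S₁ ⊆ S₂) :
    convexPerimeter S₁ ≤ convexPerimeter S₂ := by
  unfold convexPerimeter
  by_cases h₁ : (interior S₁).Nonempty
  · rw [if_pos h₁, if_pos (h₁.mono (interior_mono hsub))]
    exact hconvex₁.hausdorffMeasure_frontier_le hcompact₁.isClosed h₁ hcompact₂.isBounded hsub
  rw [if_neg h₁]
  rw [not_nonempty_iff_eq_empty] at h₁
  have hf₁ : frontier S₁ = S₁ := by rw [hcompact₁.isClosed.frontier_eq, h₁, sdiff_empty]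
  rw [hf₁]
  by_cases h₂ : (interior S₂).Nonempty
  · rw [if_pos h₂]
    exact hconvex₁.two_mul_hausdorffMeasure_le_frontier h₁ hconvex₂ hcompact₂.isBounded h₂ hsub
  · rw [if_neg h₂]
    rw [not_nonempty_iff_eq_empty] at h₂
    rw [hcompact₂.isClosed.frontier_eq, h₂, sdiff_empty]
    gcongr

/-- The circle is a Lipschitz image of a bounded interval. -/
theorem hausdorffMeasure_one_sphere_lt_top (c : ℂ) {R : ℝ} (hR : 0 ≤ R) :
    Measure.hausdorffMeasure 1 (Metric.sphere c R) < ⊤ := by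
  rw [← abs_of_nonneg hR, ← image_circleMap_Ioc]
  refine ((lipschitzWith_circleMap c R).hausdorffMeasure_image_le zero_le_one _).trans_lt ?_
  rw [hausdorffMeasure_real, Real.volume_Ioc, ENNReal.rpow_one]
  exact ENNReal.mul_lt_top ENNReal.coe_lt_top ENNReal.ofReal_lt_top

theorem convexPerimeter_lt_top {S : Set ℂ} (hcompact : IsCompact S) (hconvex : Convex ℝ S) :
    convexPerimeter S < ⊤ := by
  obtain ⟨R, hR, hS⟩ := hcompact.isBounded.subset_closedBall_lt 0 0
  refine (convexPerimeter_mono hcompact hconvex (isCompact_closedBall 0 R)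
    (convex_closedBall 0 R) hS).trans_lt ?_
  rw [convexPerimeter, if_pos, frontier_closedBall _ hR.ne']
  · exact hausdorffMeasure_one_sphere_lt_top 0 hR.le
  · rw [interior_closedBall _ hR.ne']
    exact Metric.nonempty_ball.2 hR

theorem mainTheorem8 (S₁ S₂ : Set ℂ)
    (hcompact₁ : IsCompact S₁) (hconvex₁ : Convex ℝ S₁)
    (hcompact₂ : IsCompact S₂) (hconvex₂ : Convex ℝ S₂)
    (hsub : S₁ ⊆ S₂) :
    convexPerimeter S₂ < ⊤ ∧ convexPerimeter S₁ ≤ convexPerimeter S₂ :=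
  ⟨convexPerimeter_lt_top hcompact₂ hconvex₂,
    convexPerimeter_mono hcompact₁ hconvex₁ hcompact₂ hconvex₂ hsub⟩
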